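/- Let $R$ be a commutative Noetherian local ring of Krull dimension $d$, let $\mathfrak a\subseteq R$ be an ideal, and let $M$ and $N$ be finitely generated $R$-modules such that $M$ has finite projective dimension. Suppose that at least one of $M$, $N$ is locally free over $\operatorname{Spec}(R)\setminus V(\mathfrak a)$, i.e. its localization at every prime ideal $\mathfrak p\not\supseteq\mathfrak a$ is a free $R_{\mathfrak p}$-module. For a finitely generated $R$-module $L$ let $\operatorname{grade}_R(\mathfrak a,L)$ denote the supremum of the lengths of $L$-regular sequences contained in $\mathfrak a$, with the convention $\operatorname{grade}_R(\mathfrak a,L)=\infty$ if $\mathfrak aL=L$. Let $r$ be an integer with $0\le r<d$ such that $$\operatorname{grade}_R(\mathfrak a,M)+\operatorname{grade}_R(\mathfrak a,N)\ \ge\ d+r+1 .$$ Then the local cohomology modules satisfy $H^i_{\mathfrak a}(M\otimes_R N)=0$ for all $0\le i\le r$. -/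

import Mathlib

open CategoryTheory Limits
open scoped TensorProduct

universe u

open Classical in
/-- The grade `grade_R(𝔞, M)` of an ideal `𝔞` on a module `M`: the supremum of the lengths of the
`M`-regular sequences consisting of elements of `𝔞`, with the usual convention that it is `∞`
when `𝔞 M = M`. -/
noncomputable def moduleGrade {R : Type*} [CommRing R] (𝔞 : Ideal R)
    (M : Type*) [AddCommGroup M] [Module R M] : ℕ∞ :=
  if 𝔞 • (⊤ : Submodule R M) = ⊤ then ⊤
  else ⨆ (rs : List R) (_ : ∀ x ∈ rs, x ∈ 𝔞) (_ : RingTheory.Sequence.IsRegular M rs),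
    (rs.length : ℕ∞)

/-- `M` is locally free over `Spec(R) ∖ V(𝔞)`: the localization `M_𝔭` is a free `R_𝔭`-module for
every prime ideal `𝔭` that does not contain `𝔞`. -/
def IsLocallyFreeOff {R : Type*} [CommRing R] (𝔞 : Ideal R)
    (M : Type*) [AddCommGroup M] [Module R M] : Prop :=
  ∀ 𝔭 : PrimeSpectrum R, 𝔭 ∉ PrimeSpectrum.zeroLocus (𝔞 : Set R) →
    𝔭 ∈ Module.freeLocus R M

/-!
As `H^i_𝔞(L) = colim Ext^i(R/𝔞^t, L)` vanishes for `i < grade(𝔞, L)` by Rees' characterization of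
the grade, and as `depth R ≤ d`, everything follows from the inequality
`grade(𝔞, M) + grade(𝔞, N) ≤ depth R + grade(𝔞, M ⊗ N)`. Let `p = pd M`. Since
`grade(𝔞, M) ≤ depth M`, the inequality splits in two halves, each an induction on `p` along a
short exact sequence `0 → M' → F → M → 0` with `F` free.

* `depth M + p ≤ depth R`. Choosing `M' ⊆ 𝔪F` makes `depth M + 1 ≤ depth M'`: in the critical degree
  `l = depth M'`, the map `Ext^l(k, M') → Ext^l(k, F)` is zero, either because `l < depth R`, or,
  when `M'` is free, because it is a combination of elements of `𝔪` and these act as zero on `k`.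
* `grade(𝔞, N) ≤ grade(𝔞, M ⊗ N) + p`. Off `V(𝔞)` one of `M`, `N` is free, so the kernel
  `Tor₁(M, N)` of `M' ⊗ N → F ⊗ N` is supported on `V(𝔞)`. A module of positive grade has no nonzero
  such submodule, so `0 → M' ⊗ N → F ⊗ N → M ⊗ N → 0` is exact and the grade drops by at most one.
-/

section Ext

universe w v v'

open Abelian (Ext)

lemma subsingleton_ext_of_sum_comp_eq_id {C : Type v} [Category.{v'} C] [Abelian C]
    [HasExt.{w} C] {K X Y : C} {ι : Type*} [Fintype ι]
    (g : ι → (X ⟶ Y)) (h : ι → (Y ⟶ X)) (hgh : ∑ j, g j ≫ h j = 𝟙 X) (i : ℕ)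
    [Subsingleton (Ext K Y i)] : Subsingleton (Ext K X i) := by
  refine subsingleton_of_forall_eq 0 fun e => ?_
  rw [← e.comp_mk₀_id, ← hgh, Ext.mk₀_sum, Ext.comp_sum]
  refine Finset.sum_eq_zero fun j _ => ?_
  rw [← Ext.mk₀_comp_mk₀, ← Ext.comp_assoc_of_third_deg_zero,
    Subsingleton.elim (e.comp (Ext.mk₀ (g j)) (add_zero i)) 0, Ext.zero_comp]

section ShortExact

variable {C : Type v} [Category.{v'} C] [Abelian C] [HasExt.{w} C] (K : C) {S : ShortComplex C}

lemma subsingleton_ext_X₃ (hS : S.ShortExact) {i : ℕ} (h₂ : Subsingleton (Ext K S.X₂ i))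
    (h₁ : Subsingleton (Ext K S.X₁ (i + 1))) : Subsingleton (Ext K S.X₃ i) := by
  refine subsingleton_of_forall_eq 0 fun e => ?_
  obtain ⟨x, rfl⟩ := Ext.covariant_sequence_exact₃ K hS e rfl (h₁.elim _ _)
  rw [h₂.elim x 0, Ext.zero_comp]

lemma subsingleton_ext_X₁ (hS : S.ShortExact) {i : ℕ}
    (h₃ : ∀ j < i, Subsingleton (Ext K S.X₃ j))
    (hf : ∀ e : Ext K S.X₁ i, e.comp (Ext.mk₀ S.f) (add_zero i) = 0) :
    Subsingleton (Ext K S.X₁ i) := by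
  refine subsingleton_of_forall_eq 0 fun e => ?_
  rcases i with _ | i
  · have := hS.mono_f
    exact Ext.postcomp_mk₀_injective_of_mono K S.f ((hf e).trans (map_zero _).symm)
  · obtain ⟨x, rfl⟩ := Ext.covariant_sequence_exact₁ K hS e (hf e) rfl
    rw [(h₃ i i.lt_succ_self).elim x 0, Ext.zero_comp]

end ShortExact

variable {R : Type u} [CommRing R]

lemma smul_ext_eq_zero_of_mem_annihilator_left {K X : ModuleCat.{u} R} {r : R}
    (hr : r ∈ Module.annihilator R K) {i : ℕ} (e : Ext K X i) : r • e = 0 := by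
  have hK : r • 𝟙 K = 0 := ModuleCat.hom_ext (LinearMap.ext (Module.mem_annihilator.mp hr))
  rw [← e.mk₀_id_comp, ← Ext.smul_comp, ← Ext.mk₀_smul, hK, Ext.mk₀_zero, Ext.zero_comp]

lemma smul_ext_eq_zero_of_mem_annihilator_right {K X : ModuleCat.{u} R} {r : R}
    (hr : r ∈ Module.annihilator R X) {i : ℕ} (e : Ext K X i) : r • e = 0 := by
  have hX : r • 𝟙 X = 0 := ModuleCat.hom_ext (LinearMap.ext (Module.mem_annihilator.mp hr))
  rw [← e.comp_mk₀_id, ← Ext.comp_smul, ← Ext.mk₀_smul, hX, Ext.mk₀_zero, Ext.comp_zero]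

lemma subsingleton_ext_of_annihilator_sup_eq_top {K X : ModuleCat.{u} R}
    (h : Module.annihilator R K ⊔ Module.annihilator R X = ⊤) (i : ℕ) :
    Subsingleton (Ext K X i) := by
  obtain ⟨a, ha, b, hb, hab⟩ := Submodule.mem_sup.mp ((Ideal.eq_top_iff_one _).mp h)
  refine subsingleton_of_forall_eq 0 fun e => ?_
  rw [← one_smul R e, ← hab, add_smul, smul_ext_eq_zero_of_mem_annihilator_left ha,
    smul_ext_eq_zero_of_mem_annihilator_right hb, add_zero]

end Ext

section LocalCohomology

-- `CategoryTheory.Ext` is the left derived functor of the linear Yoneda functor, in terms of which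
-- local cohomology is defined; `Abelian.Ext` is the group of morphisms in the derived category.
lemma isZero_ext_obj_of_subsingleton_ext {R : Type*} [Ring R] {C : Type*} [Category* C] [Abelian C]
    [Linear R C] [EnoughProjectives C] [HasExt C] (K X : C) (i : ℕ)
    (h : Subsingleton (Abelian.Ext K X i)) :
    IsZero (((Ext R C i).obj (Opposite.op K)).obj X) := by
  let P := projectiveResolution K
  refine IsZero.of_iso ?_ (P.isoExt i X)
  rw [← HomologicalComplex.exactAt_iff_isZero_homology]
  cases i with
  | zero =>
    rw [HomologicalComplex.exactAt_iff' _ 0 0 1 (by simp) (by simp),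
      ShortComplex.moduleCat_exact_iff]
    intro (f : P.complex.X 0 ⟶ X) (hf : P.complex.d 1 0 ≫ f = 0)
    have hK : ∀ g : K ⟶ X, g = 0 := fun g =>
      (Abelian.Ext.addEquiv₀ (X := K) (Y := X)).symm.injective (Subsingleton.elim _ _)
    have : Epi (ShortComplex.mk _ _ P.complex_d_comp_π_f_zero).g :=
      inferInstanceAs (Epi (P.π.f 0))
    have hg := P.exact₀.g_desc f hf
    have hf0 : f = 0 := hg.symm.trans ((congrArg (P.π.f 0 ≫ ·) (hK _)).trans comp_zero)
    exact ⟨0, by rw [map_zero]; exact hf0.symm⟩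
  | succ n =>
    rw [HomologicalComplex.exactAt_iff' _ n (n + 1) (n + 2) (by simp) (by simp),
      ShortComplex.moduleCat_exact_iff]
    intro (f : P.complex.X (n + 1) ⟶ X) (hf : P.complex.d (n + 2) (n + 1) ≫ f = 0)
    exact (P.extMk_eq_zero_iff f (n + 2) rfl hf n rfl).mp (Subsingleton.elim _ _)

lemma isZero_localCohomology_of_subsingleton_ext {R : Type u} [CommRing R] (𝔞 : Ideal R)
    (X : ModuleCat.{u} R) (i : ℕ)
    (h : ∀ t : ℕ, Subsingleton (Abelian.Ext (ModuleCat.of R (R ⧸ 𝔞 ^ t)) X i)) :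
    IsZero ((localCohomology 𝔞 i).obj X) := by
  let D := localCohomology.diagram (localCohomology.idealPowersDiagram 𝔞) i
  have : HasColimit D := localCohomology.hasColimitDiagram _ i
  have hc : IsColimit (((evaluation _ _).obj X).mapCocone (colimit.cocone D)) :=
    isColimitOfPreserves _ (colimit.isColimit D)
  refine (IsZero.iff_id_eq_zero _).mpr (hc.hom_ext fun j => ?_)
  exact (isZero_ext_obj_of_subsingleton_ext _ X i
    (h (Opposite.unop (Opposite.unop j)))).eq_of_src _ _

end LocalCohomology

section Grade

section

variable {R : Type*} [CommRing R] (𝔞 : Ideal R) (M : Type*) [AddCommGroup M] [Module R M]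

lemma moduleGrade_of_subsingleton [Subsingleton M] : moduleGrade 𝔞 M = ⊤ :=
  if_pos (Subsingleton.elim _ _)

lemma moduleGrade_top : moduleGrade (⊤ : Ideal R) M = ⊤ :=
  if_pos (Submodule.top_smul _)

variable {𝔞 M}

lemma lt_moduleGrade_iff_exists_isRegular (h : 𝔞 • (⊤ : Submodule R M) ≠ ⊤) {n : ℕ∞} :
    n < moduleGrade 𝔞 M ↔
      ∃ rs : List R, (∀ x ∈ rs, x ∈ 𝔞) ∧ RingTheory.Sequence.IsRegular M rs ∧ n < rs.length := by
  simp only [moduleGrade, if_neg h, lt_iSup_iff, exists_prop]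

lemma length_le_moduleGrade {rs : List R} (hrs : ∀ x ∈ rs, x ∈ 𝔞)
    (hreg : RingTheory.Sequence.IsRegular M rs) : (rs.length : ℕ∞) ≤ moduleGrade 𝔞 M := by
  rw [moduleGrade]
  split_ifs
  · exact le_top
  · exact le_iSup₂_of_le rs hrs (le_iSup_of_le hreg le_rfl)

lemma moduleGrade_le_supportDim [IsLocalRing R] [IsNoetherianRing R] [Module.Finite R M]
    (h : 𝔞 • (⊤ : Submodule R M) ≠ ⊤) : moduleGrade 𝔞 M ≤ Module.supportDim R M := by
  have : Nontrivial M := (Submodule.nontrivial_iff R).mp (nontrivial_of_ne _ _ h)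
  obtain ⟨d, hd⟩ := WithBot.ne_bot_iff_exists.mp (Module.supportDim_ne_bot_of_nontrivial R M)
  rw [← hd, WithBot.coe_le_coe]
  by_contra! hlt
  obtain ⟨rs, -, hreg, hrs⟩ := (lt_moduleGrade_iff_exists_isRegular h).mp hlt
  have : Nontrivial (M ⧸ Ideal.ofList rs • (⊤ : Submodule R M)) :=
    Submodule.Quotient.nontrivial_iff.mpr hreg.top_ne_smul.symm
  obtain ⟨e, he⟩ := WithBot.ne_bot_iff_exists.mp
    (Module.supportDim_ne_bot_of_nontrivial R (M ⧸ Ideal.ofList rs • (⊤ : Submodule R M)))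
  have hdim := Module.supportDim_add_length_eq_supportDim_of_isRegular rs hreg
  rw [← he, ← hd] at hdim
  have hed : e + (rs.length : ℕ∞) = d := by exact_mod_cast hdim
  exact hrs.not_ge (hed ▸ le_add_self)

end

lemma support_quotient_eq_zeroLocus {R : Type*} [CommRing R] (I : Ideal R) :
    Module.support R (R ⧸ I) = PrimeSpectrum.zeroLocus (I : Set R) := by
  rw [Module.support_eq_zeroLocus, Ideal.annihilator_quotient]

lemma annihilator_sup_annihilator_eq_top {R : Type*} [CommRing R] {𝔞 : Ideal R} {K M : Type*}
    [AddCommGroup K] [Module R K] [Module.Finite R K] [AddCommGroup M] [Module R M]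
    [Module.Finite R M] (hK : Module.support R K ⊆ PrimeSpectrum.zeroLocus (𝔞 : Set R))
    (h : 𝔞 • (⊤ : Submodule R M) = ⊤) :
    Module.annihilator R K ⊔ Module.annihilator R M = ⊤ := by
  have : Subsingleton (M ⧸ 𝔞 • (⊤ : Submodule R M)) := Submodule.Quotient.subsingleton_iff.mpr h
  rw [← PrimeSpectrum.zeroLocus_empty_iff_eq_top, PrimeSpectrum.zeroLocus_sup,
    ← Module.support_eq_zeroLocus, ← Module.support_eq_zeroLocus, ← Set.subset_empty_iff]
  calc Module.support R K ∩ Module.support R M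
      ⊆ Module.support R M ∩ PrimeSpectrum.zeroLocus 𝔞 := fun p hp => ⟨hp.2, hK hp.1⟩
    _ = Module.support R (M ⧸ 𝔞 • (⊤ : Submodule R M)) := (Module.support_quotient 𝔞).symm
    _ = ∅ := Module.support_eq_empty

section Rees

open Abelian (Ext)

variable {R : Type u} [CommRing R] [IsNoetherianRing R] {𝔞 : Ideal R}
  {M : Type u} [AddCommGroup M] [Module R M] [Module.Finite R M]

lemma subsingleton_ext_of_lt_moduleGrade {K : ModuleCat.{u} R} [Module.Finite R K]
    (hK : Module.support R K ⊆ PrimeSpectrum.zeroLocus (𝔞 : Set R)) {i : ℕ}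
    (hi : i < moduleGrade 𝔞 M) : Subsingleton (Ext K (ModuleCat.of R M) i) := by
  by_cases h : 𝔞 • (⊤ : Submodule R M) = ⊤
  · exact subsingleton_ext_of_annihilator_sup_eq_top
      (annihilator_sup_annihilator_eq_top hK h) i
  · obtain ⟨rs, hrs, hreg, hlt⟩ := (lt_moduleGrade_iff_exists_isRegular h).mp hi
    exact ModuleCat.subsingleton_ext_of_exists_isRegular 𝔞 K hK (ModuleCat.of R M)
      (lt_top_iff_ne_top.mpr h) rs hrs hreg i (Nat.cast_lt.mp hlt)

lemma le_moduleGrade_iff {n : ℕ} : n ≤ moduleGrade 𝔞 M ↔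
    ∀ i < n, Subsingleton (Ext (ModuleCat.of R (R ⧸ 𝔞)) (ModuleCat.of R M) i) := by
  refine ⟨fun h i hi => subsingleton_ext_of_lt_moduleGrade
    (support_quotient_eq_zeroLocus 𝔞).subset ((Nat.cast_lt.mpr hi).trans_le h), fun h => ?_⟩
  by_cases htop : 𝔞 • (⊤ : Submodule R M) = ⊤
  · simp [moduleGrade, htop]
  · obtain ⟨rs, rfl, hrs, hreg⟩ := ModuleCat.exists_isRegular_of_exists_subsingleton_ext 𝔞 n
      (ModuleCat.of R M) (lt_top_iff_ne_top.mpr htop) (ModuleCat.of R (R ⧸ 𝔞))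
      (support_quotient_eq_zeroLocus 𝔞) h
    exact length_le_moduleGrade hrs hreg

lemma moduleGrade_mono {𝔟 : Ideal R} (h : 𝔞 ≤ 𝔟) : moduleGrade 𝔞 M ≤ moduleGrade 𝔟 M := by
  refine ENat.forall_natCast_le_iff_le.mp fun n hn => le_moduleGrade_iff.mpr fun i hi => ?_
  refine subsingleton_ext_of_lt_moduleGrade ?_ ((Nat.cast_lt.mpr hi).trans_le hn)
  rw [support_quotient_eq_zeroLocus]
  exact PrimeSpectrum.zeroLocus_anti_mono h

lemma moduleGrade_le_of_sum_comp_eq_id {L : Type u} [AddCommGroup L] [Module R L]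
    [Module.Finite R L] {ι : Type*} [Fintype ι] (g : ι → L →ₗ[R] M) (h : ι → M →ₗ[R] L)
    (hgh : ∑ j, h j ∘ₗ g j = LinearMap.id) : moduleGrade 𝔞 M ≤ moduleGrade 𝔞 L := by
  refine ENat.forall_natCast_le_iff_le.mp fun n hn => le_moduleGrade_iff.mpr fun i hi => ?_
  have := le_moduleGrade_iff.mp hn i hi
  refine subsingleton_ext_of_sum_comp_eq_id (Y := ModuleCat.of R M)
    (fun j => ModuleCat.ofHom (g j)) (fun j => ModuleCat.ofHom (h j)) ?_ i
  exact ModuleCat.hom_ext (by simpa [ModuleCat.hom_sum] using hgh)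

-- The shift by one on both sides avoids a truncated `grade M₁ - 1` on the left.
lemma min_moduleGrade_le_of_exact {M₁ M₂ M₃ : Type u} [AddCommGroup M₁] [Module R M₁]
    [Module.Finite R M₁] [AddCommGroup M₂] [Module R M₂] [Module.Finite R M₂] [AddCommGroup M₃]
    [Module R M₃] [Module.Finite R M₃] {f : M₁ →ₗ[R] M₂} {g : M₂ →ₗ[R] M₃}
    (hf : Function.Injective f) (hfg : Function.Exact f g) (hg : Function.Surjective g) :
    min (moduleGrade 𝔞 M₁) (moduleGrade 𝔞 M₂ + 1) ≤ moduleGrade 𝔞 M₃ + 1 := by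
  refine ENat.forall_natCast_le_iff_le.mp fun n hn => ?_
  rcases n with _ | n
  · exact zero_le
  obtain ⟨h₁, h₂⟩ := le_min_iff.mp hn
  rw [Nat.cast_succ, ENat.add_le_add_iff_right ENat.one_ne_top] at h₂ ⊢
  have hS := ModuleCat.shortComplex_shortExact
    (ModuleCat.shortComplexOfCompEqZero f g hfg.linearMap_comp_eq_zero) hfg hf hg
  exact le_moduleGrade_iff.mpr fun i hi => subsingleton_ext_X₃ _ hS
    (le_moduleGrade_iff.mp h₂ i hi) (le_moduleGrade_iff.mp h₁ (i + 1) (Nat.succ_lt_succ hi))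

lemma moduleGrade_add_one_le_of_exact {M₁ M₂ M₃ : Type u} [AddCommGroup M₁] [Module R M₁]
    [Module.Finite R M₁] [AddCommGroup M₂] [Module R M₂] [AddCommGroup M₃] [Module R M₃]
    [Module.Finite R M₃] {f : M₁ →ₗ[R] M₂} {g : M₂ →ₗ[R] M₃} (hf : Function.Injective f)
    (hfg : Function.Exact f g) (hg : Function.Surjective g)
    (hmap : ∀ l : ℕ, moduleGrade 𝔞 M₁ = l →
      ∀ e : Ext (ModuleCat.of R (R ⧸ 𝔞)) (ModuleCat.of R M₁) l,
        e.comp (Ext.mk₀ (ModuleCat.ofHom f)) (add_zero l) = 0) :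
    moduleGrade 𝔞 M₃ + 1 ≤ moduleGrade 𝔞 M₁ := by
  have hS := ModuleCat.shortComplex_shortExact
    (ModuleCat.shortComplexOfCompEqZero f g hfg.linearMap_comp_eq_zero) hfg hf hg
  by_contra! hlt
  obtain ⟨l, hl⟩ := ENat.ne_top_iff_exists.mp hlt.ne_top
  have hl₃ : l ≤ moduleGrade 𝔞 M₃ := hl ▸ Order.le_of_lt_add_one hlt
  have hvanish : (l + 1 : ℕ) ≤ moduleGrade 𝔞 M₁ := by
    refine le_moduleGrade_iff.mpr fun i hi => ?_
    rcases Nat.lt_succ_iff_lt_or_eq.mp hi with hi | rfl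
    · exact le_moduleGrade_iff.mp hl.le i hi
    · exact subsingleton_ext_X₁ _ hS (le_moduleGrade_iff.mp hl₃) (hmap i hl.symm)
  exact (Nat.lt_succ_self l).not_ge (Nat.cast_le.mp (hl ▸ hvanish))

lemma eq_bot_of_support_subset_zeroLocus (hM : 0 < moduleGrade 𝔞 M) {P : Submodule R M}
    (hP : Module.support R P ⊆ PrimeSpectrum.zeroLocus (𝔞 : Set R)) : P = ⊥ := by
  have := subsingleton_ext_of_lt_moduleGrade (K := ModuleCat.of R P) (i := 0) hP hM
  have h0 : ModuleCat.ofHom P.subtype = 0 := Ext.addEquiv₀.symm.injective (Subsingleton.elim _ _)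
  rw [← P.range_subtype, LinearMap.range_eq_bot]
  exact congrArg ModuleCat.Hom.hom h0

lemma isZero_localCohomology_of_lt_moduleGrade {i : ℕ} (hi : i < moduleGrade 𝔞 M) :
    IsZero ((localCohomology 𝔞 i).obj (ModuleCat.of R M)) := by
  refine isZero_localCohomology_of_subsingleton_ext 𝔞 _ i fun t =>
    subsingleton_ext_of_lt_moduleGrade ?_ hi
  rw [support_quotient_eq_zeroLocus]
  exact fun p hp => p.2.le_of_pow_le hp

end Rees

end Grade

section LocallyFree

variable {R : Type*} [CommRing R] {𝔞 : Ideal R} {M₁ M₂ M₃ N : Type*}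
  [AddCommGroup M₁] [Module R M₁] [AddCommGroup M₂] [Module R M₂] [AddCommGroup M₃] [Module R M₃]
  [AddCommGroup N] [Module R N] {f : M₁ →ₗ[R] M₂} {g : M₂ →ₗ[R] M₃}

open LocalizedModule (mkLinearMap)

lemma IsLocallyFreeOff.flat_localizedModule (h : IsLocallyFreeOff 𝔞 N) {p : PrimeSpectrum R}
    (hp : p ∉ PrimeSpectrum.zeroLocus (𝔞 : Set R)) :
    Module.Flat R (LocalizedModule p.asIdeal.primeCompl N) := by
  have := Module.mem_freeLocus.mp (h p hp)
  exact Module.Flat.trans R (Localization.AtPrime p.asIdeal) _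

lemma IsLocallyFreeOff.of_exact [Module.Finite R M₁] [Module.Projective R M₂]
    (h : IsLocallyFreeOff 𝔞 M₃) (hf : Function.Injective f) (hfg : Function.Exact f g)
    (hg : Function.Surjective g) : IsLocallyFreeOff 𝔞 M₁ := by
  intro p hp
  let S := p.asIdeal.primeCompl
  have := Module.mem_freeLocus.mp (h p hp)
  let fS := LocalizedModule.map S f
  have hfS : Function.Injective fS := LocalizedModule.map_injective S f hf
  have hexact : Function.Exact fS (LocalizedModule.map S g) := LocalizedModule.map_exact S f g hfg
  have hsplit : Function.Injective fS ∧ ∃ σ, LocalizedModule.map S g ∘ₗ σ = LinearMap.id :=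
    ⟨hfS, Module.projective_lifting_property _ _ (LocalizedModule.map_surjective S g hg)⟩
  obtain ⟨-, ρ, hρ⟩ := (hexact.split_tfae'.out 0 1).mp hsplit
  have : Module.Projective (Localization S) (LocalizedModule S M₁) :=
    Module.Projective.of_split fS ρ hρ
  exact Module.mem_freeLocus.mpr Module.free_of_flat_of_isLocalRing

lemma support_ker_rTensor_subset_zeroLocus (h : IsLocallyFreeOff 𝔞 M₃ ∨ IsLocallyFreeOff 𝔞 N)
    (hf : Function.Injective f) (hfg : Function.Exact f g) (hg : Function.Surjective g) :
    Module.support R (LinearMap.ker (f.rTensor N)) ⊆ PrimeSpectrum.zeroLocus (𝔞 : Set R) := by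
  intro p
  contrapose!
  intro hp
  let S := p.asIdeal.primeCompl
  let fS := IsLocalizedModule.map S (mkLinearMap S M₁) (mkLinearMap S M₂) f
  have hfS : Function.Injective fS := IsLocalizedModule.map_injective S _ _ f hf
  have hinj : Function.Injective (fS.rTensor (LocalizedModule S N)) := by
    rcases h with h | h
    · have := h.flat_localizedModule hp
      exact (LinearMap.lTensor_inj_iff_rTensor_inj _ _).mp
        (LinearMap.lTensor_injective_of_exact_of_flat _
        (IsLocalizedModule.map_surjective S _ (mkLinearMap S M₃) g hg) fS hfS
        (IsLocalizedModule.map_exact S _ _ _ f g hfg) _)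
    · have := h.flat_localizedModule hp
      exact Module.Flat.rTensor_preserves_injective_linearMap fS hfS
  have hcomm : fS.rTensor (LocalizedModule S N) ∘ₗ
      TensorProduct.map (mkLinearMap S M₁) (mkLinearMap S N) =
      TensorProduct.map (mkLinearMap S M₂) (mkLinearMap S N) ∘ₗ f.rTensor N :=
    TensorProduct.ext' fun x y => by
      simp only [fS, LinearMap.comp_apply, TensorProduct.map_tmul, LinearMap.rTensor_tmul,
        IsLocalizedModule.map_apply]
  rw [Module.notMem_support_iff']
  rintro ⟨z, hz⟩
  have hzS : TensorProduct.map (mkLinearMap S M₁) (mkLinearMap S N) z = 0 := by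
    refine hinj ((LinearMap.congr_fun hcomm z).trans ?_)
    rw [LinearMap.comp_apply, LinearMap.mem_ker.mp hz, map_zero, map_zero]
  obtain ⟨s, hs⟩ := (IsLocalizedModule.eq_zero_iff S _).mp hzS
  exact ⟨s, s.2, Subtype.ext hs⟩

end LocallyFree

section TensorProduct

variable {R : Type u} [CommRing R] [IsNoetherianRing R] {𝔞 : Ideal R}
  {N : Type u} [AddCommGroup N] [Module R N] [Module.Finite R N]

lemma moduleGrade_le_moduleGrade_tensorProduct_of_projective (P : Type u) [AddCommGroup P]
    [Module R P] [Module.Finite R P] [Module.Projective R P] :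
    moduleGrade 𝔞 N ≤ moduleGrade 𝔞 (P ⊗[R] N) := by
  obtain ⟨n, f, g, -, -, hfg⟩ := Module.Finite.exists_comp_eq_id_of_projective R P
  refine moduleGrade_le_of_sum_comp_eq_id
    (fun j => (TensorProduct.lid R N).toLinearMap ∘ₗ (LinearMap.proj j ∘ₗ g).rTensor N)
    (fun j => TensorProduct.mk R P N (f (Pi.single j 1))) (TensorProduct.ext' fun x y => ?_)
  have hx : ∑ j, g x j • f (Pi.single j 1) = x :=
    calc ∑ j, g x j • f (Pi.single j 1)
        = f (∑ j, Pi.single j (g x j)) := by simp [← map_smul, ← Pi.single_smul]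
      _ = f (g x) := by rw [Finset.univ_sum_single]
      _ = x := LinearMap.congr_fun hfg x
  conv_rhs => rw [LinearMap.id_apply, ← hx, TensorProduct.sum_tmul]
  simp [LinearMap.sum_apply, TensorProduct.smul_tmul]

lemma min_moduleGrade_tensorProduct_le_of_exact {M' P M : Type u} [AddCommGroup M'] [Module R M']
    [Module.Finite R M'] [AddCommGroup P] [Module R P] [Module.Finite R P] [Module.Projective R P]
    [AddCommGroup M] [Module R M] [Module.Finite R M] {f : M' →ₗ[R] P} {g : P →ₗ[R] M}
    (h : IsLocallyFreeOff 𝔞 M ∨ IsLocallyFreeOff 𝔞 N) (hf : Function.Injective f)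
    (hfg : Function.Exact f g) (hg : Function.Surjective g) :
    min (moduleGrade 𝔞 (M' ⊗[R] N)) (moduleGrade 𝔞 N + 1) ≤ moduleGrade 𝔞 (M ⊗[R] N) + 1 := by
  rcases eq_zero_or_pos (moduleGrade 𝔞 (M' ⊗[R] N)) with h₀ | hpos
  · simp [h₀]
  have hinj : Function.Injective (f.rTensor N) := LinearMap.ker_eq_bot.mp <|
    eq_bot_of_support_subset_zeroLocus hpos (support_ker_rTensor_subset_zeroLocus h hf hfg hg)
  calc min (moduleGrade 𝔞 (M' ⊗[R] N)) (moduleGrade 𝔞 N + 1)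
      ≤ min (moduleGrade 𝔞 (M' ⊗[R] N)) (moduleGrade 𝔞 (P ⊗[R] N) + 1) := by
        gcongr
        exact moduleGrade_le_moduleGrade_tensorProduct_of_projective P
    _ ≤ moduleGrade 𝔞 (M ⊗[R] N) + 1 :=
        min_moduleGrade_le_of_exact hinj (rTensor_exact N hfg hg)
          (LinearMap.rTensor_surjective N hg)

lemma moduleGrade_le_moduleGrade_tensorProduct_add {M : Type u} [AddCommGroup M] [Module R M]
    [Module.Finite R M] (h : IsLocallyFreeOff 𝔞 M ∨ IsLocallyFreeOff 𝔞 N) {p : ℕ}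
    (hM : HasProjectiveDimensionLE (ModuleCat.of R M) p) :
    moduleGrade 𝔞 N ≤ moduleGrade 𝔞 (M ⊗[R] N) + p := by
  induction p generalizing M with
  | zero =>
    have : Module.Projective R M := (IsProjective.iff_projective M).mpr
      ((projective_iff_hasProjectiveDimensionLE_zero _).mpr hM)
    simpa using moduleGrade_le_moduleGrade_tensorProduct_of_projective M
  | succ p ih =>
    obtain ⟨m, g, hg⟩ := Module.Finite.exists_fin' R M
    have hfg := LinearMap.exact_subtype_ker_map g
    have hker : moduleGrade 𝔞 N ≤ moduleGrade 𝔞 (LinearMap.ker g ⊗[R] N) + p :=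
      ih (h.imp_left fun h => h.of_exact Subtype.val_injective hfg hg)
        (((LinearMap.shortExact_shortComplexKer hg).hasProjectiveDimensionLT_X₃_iff p
          inferInstance).mp hM)
    calc moduleGrade 𝔞 N
        ≤ min (moduleGrade 𝔞 (LinearMap.ker g ⊗[R] N)) (moduleGrade 𝔞 N + 1) + p := by
          rw [← min_add_add_right]
          exact le_min hker (le_self_add.trans le_self_add)
      _ ≤ moduleGrade 𝔞 (M ⊗[R] N) + 1 + p := by
          gcongr
          exact min_moduleGrade_tensorProduct_le_of_exact h Subtype.val_injective hfg hg
      _ = moduleGrade 𝔞 (M ⊗[R] N) + (p + 1 : ℕ) := by push_cast; ring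

end TensorProduct

section AuslanderBuchsbaum

open Abelian (Ext)
open IsLocalRing

lemma projectiveDimension_X₁_of_projective_X₂ {C : Type*} [Category* C] [Abelian C]
    {S : ShortComplex C} (hS : S.ShortExact) [Projective S.X₂] {p : ℕ}
    (h : projectiveDimension S.X₃ = (p + 1 : ℕ)) : projectiveDimension S.X₁ = p := by
  have hle := (projectiveDimension_le_iff S.X₃ (p + 1)).mp h.le
  have hge := (projectiveDimension_ge_iff S.X₃ (p + 1)).mp h.ge
  refine le_antisymm ((projectiveDimension_le_iff S.X₁ p).mpr
    ((hS.hasProjectiveDimensionLT_X₃_iff p inferInstance).mp hle))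
    ((projectiveDimension_ge_iff S.X₁ p).mpr fun hlt => hge ?_)
  exact hS.hasProjectiveDimensionLT_X₃ p hlt (hasProjectiveDimensionLT_of_ge _ 1 _ (by omega))

lemma exists_surjective_ker_le_maximalIdeal_smul_top (R : Type*) [CommRing R] [IsLocalRing R]
    (M : Type*) [AddCommGroup M] [Module R M] [Module.Finite R M] :
    ∃ (n : ℕ) (π : (Fin n → R) →ₗ[R] M), Function.Surjective π ∧
      LinearMap.ker π ≤ maximalIdeal R • ⊤ := by
  let b := Module.finBasis (ResidueField R) (ResidueField R ⊗[R] M)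
  choose f hf using fun i =>
    TensorProduct.mk_surjective R M (ResidueField R) Ideal.Quotient.mk_surjective (b i)
  refine ⟨_, Fintype.linearCombination R f, ?_, fun z hz => ?_⟩
  · rw [← LinearMap.range_eq_top, Fintype.range_linearCombination]
    exact span_eq_top_of_tmul_eq_basis f b hf
  have hsum : ∑ j, residue R (z j) • b j = 0 := by
    calc ∑ j, residue R (z j) • b j
        = ∑ j, TensorProduct.mk R (ResidueField R) M 1 (z j • f j) := by
          simp only [map_smul, hf]
          exact Finset.sum_congr rfl fun j _ => algebraMap_smul (ResidueField R) (z j) (b j)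
      _ = TensorProduct.mk R (ResidueField R) M 1 (Fintype.linearCombination R f z) := by
          rw [Fintype.linearCombination_apply, map_sum]
      _ = 0 := by rw [LinearMap.mem_ker.mp hz, map_zero]
  have hz : ∀ i, z i ∈ maximalIdeal R := fun i =>
    (residue_eq_zero_iff _).mp (Fintype.linearIndependent_iff.mp b.linearIndependent _ hsum i)
  rw [pi_eq_sum_univ z]
  exact Submodule.sum_mem _ fun i _ => Submodule.smul_mem_smul (hz i) trivial

lemma exists_eq_sum_smul_of_range_le_smul_top {R : Type*} [CommRing R] {I : Ideal R} (hI : I.FG)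
    {P Q : Type*} [AddCommGroup P] [Module R P] [Module.Projective R P] [AddCommGroup Q]
    [Module R Q] {f : P →ₗ[R] Q} (hf : LinearMap.range f ≤ I • ⊤) :
    ∃ (n : ℕ) (x : Fin n → R) (ψ : Fin n → P →ₗ[R] Q), (∀ j, x j ∈ I) ∧ f = ∑ j, x j • ψ j := by
  obtain ⟨n, x, hx⟩ := Submodule.fg_iff_exists_fin_generating_family.mp hI
  let Φ : (Fin n → Q) →ₗ[R] Q := ∑ j, x j • LinearMap.proj j
  have hΦ : I • (⊤ : Submodule R Q) ≤ LinearMap.range Φ := by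
    refine Submodule.smul_le.mpr fun r hr q _ => ?_
    obtain ⟨c, rfl⟩ := (Submodule.mem_span_range_iff_exists_fun R).mp (hx ▸ hr)
    exact ⟨fun j => c j • q, by simp [Φ, Finset.sum_smul, smul_smul, mul_comm]⟩
  obtain ⟨Ψ, hΨ⟩ := Module.projective_lifting_property Φ.rangeRestrict
    (f.codRestrict _ fun z => hΦ (hf ⟨z, rfl⟩)) Φ.surjective_rangeRestrict
  refine ⟨n, x, fun j => LinearMap.proj j ∘ₗ Ψ, fun j => hx ▸ Submodule.subset_span ⟨j, rfl⟩,
    LinearMap.ext fun z => ?_⟩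
  calc f z = Φ (Ψ z) := (congrArg Subtype.val (LinearMap.congr_fun hΨ z)).symm
    _ = _ := by simp [Φ]

lemma comp_mk₀_eq_zero_of_range_le_smul_top {R : Type u} [CommRing R] {I : Ideal R} (hI : I.FG)
    {K : ModuleCat.{u} R} (hK : I ≤ Module.annihilator R K) {P Q : Type u} [AddCommGroup P]
    [Module R P] [Module.Projective R P] [AddCommGroup Q] [Module R Q] {f : P →ₗ[R] Q}
    (hf : LinearMap.range f ≤ I • ⊤) {i : ℕ} (e : Ext K (ModuleCat.of R P) i) :
    e.comp (Ext.mk₀ (ModuleCat.ofHom f)) (add_zero i) = 0 := by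
  obtain ⟨n, x, ψ, hx, rfl⟩ := exists_eq_sum_smul_of_range_le_smul_top hI hf
  have hsum : ModuleCat.ofHom (∑ j, x j • ψ j) = ∑ j, x j • ModuleCat.ofHom (ψ j) := by
    ext; simp
  rw [hsum, Ext.mk₀_sum, Ext.comp_sum]
  refine Finset.sum_eq_zero fun j _ => ?_
  rw [Ext.mk₀_smul, Ext.comp_smul, smul_ext_eq_zero_of_mem_annihilator_left (hK (hx j))]

variable {R : Type u} [CommRing R] [IsNoetherianRing R]

lemma moduleGrade_self_le_moduleGrade_pi (𝔞 : Ideal R) (n : ℕ) :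
    moduleGrade 𝔞 R ≤ moduleGrade 𝔞 (Fin n → R) :=
  moduleGrade_le_of_sum_comp_eq_id (fun i => LinearMap.proj i)
    (fun i => LinearMap.single R (fun _ => R) i)
    (LinearMap.ext fun v => by simpa using Finset.univ_sum_single v)

lemma moduleGrade_le_moduleGrade_self_of_free (𝔞 : Ideal R) (F : Type u) [AddCommGroup F]
    [Module R F] [Module.Finite R F] [Module.Free R F] [Nontrivial F] :
    moduleGrade 𝔞 F ≤ moduleGrade 𝔞 R := by
  let b := Module.Free.chooseBasis R F
  obtain ⟨i⟩ := b.index_nonempty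
  exact moduleGrade_le_of_sum_comp_eq_id (ι := Unit)
    (fun _ => LinearMap.toSpanSingleton R F (b i)) (fun _ => b.coord i) (by ext; simp)

variable [IsLocalRing R]

theorem moduleGrade_maximalIdeal_add_projectiveDimension_le {M : Type u} [AddCommGroup M]
    [Module R M] [Module.Finite R M] {p : ℕ} (h : projectiveDimension (ModuleCat.of R M) = p) :
    moduleGrade (maximalIdeal R) M + p ≤ moduleGrade (maximalIdeal R) R := by
  induction p generalizing M with
  | zero =>
    obtain ⟨hproj, hzero⟩ := (projectiveDimension_eq_zero_iff _).mp h
    have : Module.Projective R M := (IsProjective.iff_projective M).mpr hproj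
    have : Module.Free R M := Module.free_of_flat_of_isLocalRing
    have : Nontrivial M := not_subsingleton_iff_nontrivial.mp
      fun _ => hzero (ModuleCat.isZero_of_subsingleton _)
    simpa using moduleGrade_le_moduleGrade_self_of_free (maximalIdeal R) M
  | succ p ih =>
    obtain ⟨n, π, hπ, hmin⟩ := exists_surjective_ker_le_maximalIdeal_smul_top R M
    have hpd : projectiveDimension (ModuleCat.of R (LinearMap.ker π)) = p :=
      projectiveDimension_X₁_of_projective_X₂ (LinearMap.shortExact_shortComplexKer hπ) h
    have hsyz : moduleGrade (maximalIdeal R) M + 1 ≤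
        moduleGrade (maximalIdeal R) (LinearMap.ker π) := by
      refine moduleGrade_add_one_le_of_exact Subtype.val_injective
        (LinearMap.exact_subtype_ker_map π) hπ fun l hl e => ?_
      rcases p.eq_zero_or_pos with rfl | hp
      · have : Module.Projective R (LinearMap.ker π) := (IsProjective.iff_projective _).mpr
          ((projectiveDimension_eq_zero_iff _).mp hpd).1
        exact comp_mk₀_eq_zero_of_range_le_smul_top (IsNoetherian.noetherian (maximalIdeal R))
          Ideal.annihilator_quotient.ge (by rwa [Submodule.range_subtype]) e
      · have hl : (l + 1 : ℕ) ≤ moduleGrade (maximalIdeal R) (Fin n → R) :=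
          calc ((l + 1 : ℕ) : ℕ∞) ≤ l + p := by exact_mod_cast Nat.add_le_add_left hp l
            _ ≤ moduleGrade (maximalIdeal R) R := hl ▸ ih hpd
            _ ≤ _ := moduleGrade_self_le_moduleGrade_pi _ n
        exact (le_moduleGrade_iff.mp hl l l.lt_succ_self).elim _ _
    calc moduleGrade (maximalIdeal R) M + (p + 1 : ℕ)
        = moduleGrade (maximalIdeal R) M + 1 + p := by push_cast; ring
      _ ≤ moduleGrade (maximalIdeal R) (LinearMap.ker π) + p := by gcongr
      _ ≤ moduleGrade (maximalIdeal R) R := ih hpd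

end AuslanderBuchsbaum

section Main

open IsLocalRing

variable {R : Type u} [CommRing R] [IsLocalRing R] [IsNoetherianRing R]

lemma moduleGrade_maximalIdeal_self_le_ringKrullDim :
    moduleGrade (maximalIdeal R) R ≤ ringKrullDim R := by
  rw [← Module.supportDim_self_eq_ringKrullDim]
  refine moduleGrade_le_supportDim ?_
  rw [smul_eq_mul, Ideal.mul_top]
  exact Ideal.IsPrime.ne_top'

theorem moduleGrade_add_moduleGrade_le {𝔞 : Ideal R} {M N : Type u} [AddCommGroup M] [Module R M]
    [Module.Finite R M] [AddCommGroup N] [Module R N] [Module.Finite R N]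
    (hpd : projectiveDimension (ModuleCat.of R M) < ⊤)
    (h : IsLocallyFreeOff 𝔞 M ∨ IsLocallyFreeOff 𝔞 N) :
    moduleGrade 𝔞 M + moduleGrade 𝔞 N ≤
      moduleGrade (maximalIdeal R) R + moduleGrade 𝔞 (M ⊗[R] N) := by
  rcases subsingleton_or_nontrivial M with hM | hM
  · rw [moduleGrade_of_subsingleton 𝔞 (M ⊗[R] N), add_top]
    exact le_top
  rcases eq_or_ne 𝔞 ⊤ with rfl | h𝔞
  · rw [moduleGrade_top (M ⊗[R] N), add_top]
    exact le_top
  obtain ⟨p, hp⟩ : ∃ p : ℕ, projectiveDimension (ModuleCat.of R M) = p := by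
    have hbot : projectiveDimension (ModuleCat.of R M) ≠ ⊥ := fun hM =>
      not_subsingleton M (ModuleCat.isZero_iff_subsingleton.mp
        ((projectiveDimension_eq_bot_iff _).mp hM))
    obtain ⟨q, hq⟩ := WithBot.ne_bot_iff_exists.mp hbot
    obtain ⟨p, rfl⟩ := ENat.ne_top_iff_exists.mp (WithBot.coe_lt_coe.mp (hq ▸ hpd)).ne
    exact ⟨p, hq.symm⟩
  calc moduleGrade 𝔞 M + moduleGrade 𝔞 N
      ≤ moduleGrade (maximalIdeal R) M + (moduleGrade 𝔞 (M ⊗[R] N) + p) := by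
        gcongr
        · exact moduleGrade_mono (le_maximalIdeal h𝔞)
        · exact moduleGrade_le_moduleGrade_tensorProduct_add h
            ((projectiveDimension_le_iff _ p).mp hp.le)
    _ = moduleGrade (maximalIdeal R) M + p + moduleGrade 𝔞 (M ⊗[R] N) := by ring
    _ ≤ moduleGrade (maximalIdeal R) R + moduleGrade 𝔞 (M ⊗[R] N) := by
        gcongr
        exact moduleGrade_maximalIdeal_add_projectiveDimension_le hp

theorem mainTheorem1_general {𝔞 : Ideal R} {M N : Type u} [AddCommGroup M] [Module R M]
    [Module.Finite R M] [AddCommGroup N] [Module R N] [Module.Finite R N]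
    (hpd : projectiveDimension (ModuleCat.of R M) < ⊤)
    (hfree : IsLocallyFreeOff 𝔞 M ∨ IsLocallyFreeOff 𝔞 N) {r : ℕ}
    (hgrade : moduleGrade (maximalIdeal R) R + r + 1 ≤ moduleGrade 𝔞 M + moduleGrade 𝔞 N) :
    ∀ i ≤ r, IsZero ((localCohomology 𝔞 i).obj (ModuleCat.of R (M ⊗[R] N))) := by
  intro i hi
  have hfin : moduleGrade (maximalIdeal R) R ≠ ⊤ := fun h =>
    (h ▸ moduleGrade_maximalIdeal_self_le_ringKrullDim (R := R)).not_gt ringKrullDim_lt_top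
  have hr : (r : ℕ∞) + 1 ≤ moduleGrade 𝔞 (M ⊗[R] N) := by
    rw [← ENat.add_le_add_iff_left hfin, ← add_assoc]
    exact hgrade.trans (moduleGrade_add_moduleGrade_le hpd hfree)
  refine isZero_localCohomology_of_lt_moduleGrade (lt_of_lt_of_le ?_ hr)
  exact_mod_cast Nat.lt_succ_of_le hi

end Main

theorem mainTheorem1 {R : Type u} [CommRing R] [IsLocalRing R] [IsNoetherianRing R]
    (𝔞 : Ideal R)
    (M : Type u) [AddCommGroup M] [Module R M] [Module.Finite R M]
    (N : Type u) [AddCommGroup N] [Module R N] [Module.Finite R N]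
    (hpd : projectiveDimension (ModuleCat.of R M) < ⊤)
    (hfree : IsLocallyFreeOff 𝔞 M ∨ IsLocallyFreeOff 𝔞 N)
    (d : ℕ) (hd : ringKrullDim R = d)
    (r : ℕ) (hr : r < d)
    (hgrade : (d : ℕ∞) + r + 1 ≤ moduleGrade 𝔞 M + moduleGrade 𝔞 N) :
    ∀ i ≤ r, IsZero ((localCohomology 𝔞 i).obj (ModuleCat.of R (M ⊗[R] N))) := by
  have hdepth : moduleGrade (IsLocalRing.maximalIdeal R) R ≤ d := by
    exact_mod_cast hd ▸ moduleGrade_maximalIdeal_self_le_ringKrullDim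
  exact mainTheorem1_general hpd hfree (le_trans (by gcongr) hgrade)
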